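/- An ideal on $\mathbb N$ is a family $\mathcal I$ of subsets of $\mathbb N$ that contains every finite subset of $\mathbb N$ and is closed under taking subsets and finite unions ($\mathcal I=\mathcal P(\mathbb N)$ is allowed). For such an ideal, let $$c_{0,\mathcal I}=\{(x_n)\in\ell_\infty : \{n\in\mathbb N : |x_n|\ge\varepsilon\}\in\mathcal I\ \text{ for every }\varepsilon>0\},$$ a linear subspace of the real Banach space $\ell_\infty$ of bounded real sequences, endowed with the sup norm. Two ideals $\mathcal I$ and $\mathcal J$ on $\mathbb N$ are called isomorphic if there is a bijection $f\colon\mathbb N\to\mathbb N$ such that, for all $A\subseteq\mathbb N$, $A\in\mathcal J$ if and only if $f^{-1}(A)\in\mathcal I$. Theorem. Let $\mathcal I$ and $\mathcal J$ be ideals on $\mathbb N$. Then there is a surjective linear isometry from $c_{0,\mathcal I}$ onto $c_{0,\mathcal J}$ if and only if $\mathcal I$ and $\mathcal J$ are isomorphic. -/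

import Mathlib

open scoped ENNReal

/-- The sequence `x` is `I`-convergent to `a`: for every `ε > 0`, the set
`{n | |x n - a| ≥ ε}` belongs to the ideal `I` of subsets of `ℕ`. -/
def IdealTendsto (I : Order.Ideal (Set ℕ)) (x : ℕ → ℝ) (a : ℝ) : Prop :=
  ∀ ε : ℝ, 0 < ε → {n : ℕ | ε ≤ |x n - a|} ∈ I

/-- The space `c_{0,I}` of all bounded real sequences that are `I`-convergent to `0`, as a
linear subspace of `ℓ^∞`; it carries the sup norm induced from `ℓ^∞`. -/
def c0Ideal (I : Order.Ideal (Set ℕ)) : Submodule ℝ (lp (fun _ : ℕ => ℝ) ∞) where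
  carrier := {x | IdealTendsto I (fun n => x n) 0}
  zero_mem' := by
    intro ε hε
    have h : {n : ℕ | ε ≤ |(0 : lp (fun _ : ℕ => ℝ) ∞) n - 0|} = ⊥ := by
      ext n
      simp [hε]
    rw [h]
    exact I.bot_mem
  add_mem' := by
    intro x y hx hy ε hε
    refine I.lower ?_ (I.sup_mem (hx (ε / 2) (half_pos hε)) (hy (ε / 2) (half_pos hε)))
    intro n hn
    by_contra hc
    simp only [Set.sup_eq_union, Set.mem_union, Set.mem_ofPred_eq, not_or, not_le, sub_zero] at hc hn
    have h1 : |(x + y : lp (fun _ : ℕ => ℝ) ∞) n| ≤ |x n| + |y n| := abs_add_le (x n) (y n)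
    linarith [hc.1, hc.2]
  smul_mem' := by
    intro c x hx ε hε
    refine I.lower ?_ (hx (ε / (|c| + 1)) (by positivity))
    intro n hn
    simp only [Set.mem_ofPred_eq, sub_zero] at hn ⊢
    have h1 : |(c • x : lp (fun _ : ℕ => ℝ) ∞) n| = |c| * |x n| := abs_mul c (x n)
    rw [h1] at hn
    rw [div_le_iff₀ (by positivity)]
    nlinarith [abs_nonneg (x n)]

/-- Two ideals `I`, `J` of subsets of `ℕ` are isomorphic if there is a bijection `f : ℕ → ℕ`
such that `A ∈ J` if and only if `f ⁻¹' A ∈ I`, for all `A ⊆ ℕ`. -/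
def IdealIsomorphic (I J : Order.Ideal (Set ℕ)) : Prop :=
  ∃ f : ℕ → ℕ, Function.Bijective f ∧ ∀ A : Set ℕ, A ∈ J ↔ f ⁻¹' A ∈ I

/-!
An isomorphism `f` of ideals induces the isometry `x ↦ x ∘ f` between the sequence spaces
(`c0Ideal.compEquiv`).

Conversely, a surjective isometry `T : c_{0,I} → c_{0,J}` is a weighted permutation of the
coordinates, which is the content of `c0Ideal.exists_coord_eq`. The unit sequence `e n` satisfies
`c_{0,I} = ℝ e n ⊕ {y | y n = 0}` with `‖s e n + y‖ = max |s| ‖y‖`, and this decomposition is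
transported by `T`. Hence `v = T (e n)` obeys `|(T y) k| + ‖y‖ |v k| ≤ ‖y‖` whenever `y n = 0`
(`c0Ideal.abs_apply_add_le`), so that images of such `y` are small wherever `v` is large.
Decomposing unit sequences of `c_{0,J}`, this inequality forces `v` to be supported at one index
`m`, where it equals `±1`; the same inequality then makes `T y` vanish at `m` if `y n = 0`, i.e.
`(T x) m = ± x n` for all `x`. Applying this to `T` and to `T⁻¹` gives two maps on indices that are
inverse to each other, and comparing `T` on indicator sequences of members of the ideals shows that
they carry one ideal to the other.
-/

namespace c0Ideal

variable {I J : Order.Ideal (Set ℕ)}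

theorem abs_apply_le_norm (x : c0Ideal I) (k : ℕ) : |x.1 k| ≤ ‖x‖ :=
  lp.norm_apply_le_norm ENNReal.top_ne_zero x.1 k

theorem norm_le_of_forall_abs_le (x : c0Ideal I) {C : ℝ} (hC : 0 ≤ C) (h : ∀ k, |x.1 k| ≤ C) :
    ‖x‖ ≤ C :=
  lp.norm_le_of_forall_le hC h

/-! ### Isometries induced by isomorphisms of ideals -/

/-- Composition with `f` as a map `c_{0,J} → c_{0,I}`, when preimages under `f` of members of `J`
belong to `I`. -/
noncomputable def comp (f : ℕ → ℕ) (hf : ∀ A ∈ J, f ⁻¹' A ∈ I) : c0Ideal J →ₗ[ℝ] c0Ideal I where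
  toFun x := ⟨⟨fun n => x.1 (f n), memℓp_infty ⟨‖x‖, by
    rintro _ ⟨n, rfl⟩
    exact abs_apply_le_norm x (f n)⟩⟩, fun ε hε => hf _ (x.2 ε hε)⟩
  map_add' _ _ := rfl
  map_smul' _ _ := rfl

theorem comp_apply (f : ℕ → ℕ) (hf : ∀ A ∈ J, f ⁻¹' A ∈ I) (x : c0Ideal J) (n : ℕ) :
    (comp f hf x).1 n = x.1 (f n) := rfl

/-- The surjective isometry `c_{0,J} → c_{0,I}`, `x ↦ x ∘ f`, induced by a permutation `f` of `ℕ`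
that identifies `I` with `J`. -/
noncomputable def compEquiv (f : ℕ ≃ ℕ) (hf : ∀ A : Set ℕ, A ∈ J ↔ f ⁻¹' A ∈ I) :
    c0Ideal J ≃ₗᵢ[ℝ] c0Ideal I where
  toLinearEquiv := LinearEquiv.ofLinearMap (comp f fun A hA => (hf A).1 hA)
    (comp f.symm fun A hA => (hf _).2 (by simpa [← Set.preimage_comp] using hA))
    (by ext x n; simp [comp_apply]) (by ext x n; simp [comp_apply])
  norm_map' x := by
    refine le_antisymm (norm_le_of_forall_abs_le _ (norm_nonneg _) fun k => ?_)
      (norm_le_of_forall_abs_le _ (norm_nonneg _) fun k => ?_)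
    · exact abs_apply_le_norm x (f k)
    · have h := abs_apply_le_norm (comp f (fun A hA => (hf A).1 hA) x) (f.symm k)
      rw [comp_apply, f.apply_symm_apply] at h
      exact h

/-! ### Indicator sequences and unit sequences -/

/-- The indicator sequence of a member `A` of the ideal, as an element of `c_{0,I}`. -/
noncomputable def ind (A : Set ℕ) (hA : A ∈ I) : c0Ideal I :=
  ⟨⟨A.indicator 1, memℓp_infty ⟨1, by
    rintro _ ⟨n, rfl⟩
    by_cases hn : n ∈ A <;> simp [hn]⟩⟩, fun ε hε => I.lower (fun n hn => by
      by_contra h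
      simp only [Set.mem_ofPred_eq, sub_zero, Set.indicator_of_notMem h, abs_zero] at hn
      linarith) hA⟩

theorem ind_apply (A : Set ℕ) (hA : A ∈ I) (n : ℕ) : (ind A hA).1 n = A.indicator 1 n := rfl

theorem exists_unit (hI : ∀ A : Set ℕ, A.Finite → A ∈ I) (n : ℕ) :
    ∃ e : c0Ideal I, e.1 n = 1 ∧ (∀ k, k ≠ n → e.1 k = 0) ∧ ‖e‖ = 1 := by
  have h1 : (ind {n} (hI _ (Set.finite_singleton n))).1 n = 1 := by simp [ind_apply]
  have h0 : ∀ k, k ≠ n → (ind {n} (hI _ (Set.finite_singleton n))).1 k = 0 := fun k hk => by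
    simp [ind_apply, hk]
  refine ⟨_, h1, h0, le_antisymm (norm_le_of_forall_abs_le _ zero_le_one fun k => ?_) ?_⟩
  · by_cases hk : k = n
    · rw [hk, h1, abs_one]
    · rw [h0 k hk, abs_zero]; exact zero_le_one
  · simpa [h1] using abs_apply_le_norm (ind {n} (hI _ (Set.finite_singleton n))) n

/-! ### Surjective isometries permute the coordinates up to sign -/

/-- If `e` is the unit sequence at `n` and `y n = 0`, then `‖s e + y‖ ≤ ‖y‖` for `|s| = ‖y‖`;
reading this at a coordinate of `T (s e + y)`, with the sign of `s` chosen suitably, gives the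
estimate. -/
theorem abs_apply_add_le (T : c0Ideal I ≃ₗᵢ[ℝ] c0Ideal J) {n : ℕ} {e : c0Ideal I}
    (he : e.1 n = 1) (he' : ∀ k, k ≠ n → e.1 k = 0) {y : c0Ideal I} (hy : y.1 n = 0) (k : ℕ) :
    |(T y).1 k| + ‖y‖ * |(T e).1 k| ≤ ‖y‖ := by
  have key : ∀ s : ℝ, |s| = ‖y‖ → |(T y).1 k + s * (T e).1 k| ≤ ‖y‖ := by
    intro s hs
    have h1 : ‖y + s • e‖ ≤ ‖y‖ := by
      refine norm_le_of_forall_abs_le _ (norm_nonneg _) fun j => ?_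
      have hj : (y + s • e).1 j = y.1 j + s * e.1 j := rfl
      rw [hj]
      by_cases hjn : j = n
      · rw [hjn, hy, he, zero_add, mul_one, hs]
      · rw [he' j hjn, mul_zero, add_zero]
        exact abs_apply_le_norm y j
    have h2 := abs_apply_le_norm (T (y + s • e)) k
    rw [T.norm_map, map_add, map_smul] at h2
    exact h2.trans h1
  have hp := abs_le.1 (key ‖y‖ (abs_norm y))
  have hm := abs_le.1 (key (-‖y‖) (by rw [abs_neg, abs_norm]))
  rcases abs_cases ((T y).1 k) with h | h <;> rcases abs_cases ((T e).1 k) with h' | h' <;>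
    rw [h.1, h'.1] <;> linarith [hp.1, hp.2, hm.1, hm.2]

/-- The `n`-th coordinate of the preimage of a unit sequence at a support point of `T (e n)`
has modulus `1`. -/
theorem abs_symm_unit_apply (T : c0Ideal I ≃ₗᵢ[ℝ] c0Ideal J) {n m : ℕ} {e : c0Ideal I}
    (he : e.1 n = 1) (he' : ∀ k, k ≠ n → e.1 k = 0) {d : c0Ideal J} (hd : d.1 m = 1)
    (hd1 : ‖d‖ = 1) (hm : (T e).1 m ≠ 0) : |(T.symm d).1 n| = 1 := by
  set a := (T.symm d).1 n with ha
  have hs : ∀ j, |(T.symm d).1 j| ≤ 1 := fun j => by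
    simpa [hd1] using abs_apply_le_norm (T.symm d) j
  -- Split `d = a • T e + T y` with `y n = 0` and `‖y‖ ≤ 1`.
  obtain ⟨y, hy⟩ : ∃ y, y = T.symm d - a • e := ⟨_, rfl⟩
  have hyj : ∀ j, y.1 j = (T.symm d).1 j - a * e.1 j := fun j => by rw [hy]; rfl
  have hyn : y.1 n = 0 := by rw [hyj, he, ← ha]; ring
  have hy1 : ‖y‖ ≤ 1 := by
    refine norm_le_of_forall_abs_le _ zero_le_one fun j => ?_
    by_cases hj : j = n
    · rw [hj, hyn, abs_zero]; exact zero_le_one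
    · rw [hyj, he' j hj, mul_zero, sub_zero]; exact hs j
  have hTy : (T y).1 m = 1 - a * (T e).1 m := by
    rw [hy, map_sub, map_smul, T.apply_symm_apply, ← hd]; rfl
  have h1 := abs_apply_add_le T he he' hyn m
  rw [hTy] at h1
  have h2 : 1 - |a| * |(T e).1 m| ≤ |1 - a * (T e).1 m| := by
    rw [← abs_mul]; linarith [le_abs_self (1 - a * (T e).1 m), le_abs_self (a * (T e).1 m)]
  have hv0 : 0 < |(T e).1 m| := abs_pos.2 hm
  have he1 : ‖e‖ ≤ 1 := norm_le_of_forall_abs_le _ zero_le_one fun j => by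
    by_cases hj : j = n
    · rw [hj, he, abs_one]
    · rw [he' j hj, abs_zero]; exact zero_le_one
  have hv1 : |(T e).1 m| ≤ 1 :=
    (abs_apply_le_norm (T e) m).trans (by rw [T.norm_map]; exact he1)
  have ha1 : |a| ≤ 1 := hs n
  have h3 : ‖y‖ * (1 - |(T e).1 m|) ≤ 1 * (1 - |(T e).1 m|) :=
    mul_le_mul_of_nonneg_right hy1 (by linarith)
  have h4 : 1 * |(T e).1 m| ≤ |a| * |(T e).1 m| := by linarith
  exact le_antisymm ha1 (le_of_mul_le_mul_right h4 hv0)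

/-- Every coordinate functional of the domain is, up to sign, a coordinate functional of the
codomain composed with `T`. -/
theorem exists_coord_eq (hI : ∀ A : Set ℕ, A.Finite → A ∈ I) (hJ : ∀ A : Set ℕ, A.Finite → A ∈ J)
    (T : c0Ideal I ≃ₗᵢ[ℝ] c0Ideal J) (n : ℕ) :
    ∃ m : ℕ, ∃ s : ℝ, |s| = 1 ∧ ∀ x : c0Ideal I, (T x).1 m = s * x.1 n := by
  obtain ⟨e, he, he', he1⟩ := exists_unit hI n
  have hTe : ‖T e‖ = 1 := by rw [T.norm_map, he1]
  obtain ⟨m, hm⟩ : ∃ m, (T e).1 m ≠ 0 := by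
    by_contra! h
    have := norm_le_of_forall_abs_le (T e) le_rfl fun k => by rw [h k, abs_zero]
    linarith
  obtain ⟨d, hd, hd', hd1⟩ := exists_unit hJ m
  have ha := abs_symm_unit_apply T he he' hd hd1 hm
  have hsupp : ∀ k, k ≠ m → (T e).1 k = 0 := by
    intro k hk
    by_contra hk0
    obtain ⟨c, hc, hc', hc1⟩ := exists_unit hJ k
    have hb := abs_symm_unit_apply T he he' hc hc1 hk0
    set a := (T.symm d).1 n
    set b := (T.symm c).1 n
    -- As `b ^ 2 = 1`, the preimage of the norm-one sequence `d - (a * b) • c` vanishes at `n`.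
    have hbb : b * b = 1 := by rw [← abs_mul_abs_self, hb, one_mul]
    obtain ⟨y, hy⟩ : ∃ y, y = T.symm (d - (a * b) • c) := ⟨_, rfl⟩
    have hyn : y.1 n = 0 := by
      rw [hy, map_sub, map_smul]
      change a - a * b * b = 0
      rw [mul_assoc, hbb, mul_one, sub_self]
    have hTy : ∀ j, (T y).1 j = d.1 j - a * b * c.1 j := fun j => by
      rw [hy, T.apply_symm_apply]; rfl
    have hy1 : ‖y‖ ≤ 1 := by
      rw [← T.norm_map]
      refine norm_le_of_forall_abs_le _ zero_le_one fun j => ?_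
      rw [hTy]
      by_cases hjm : j = m
      · rw [hjm, hd, hc' m hk.symm, mul_zero, sub_zero, abs_one]
      · rw [hd' j hjm, zero_sub, abs_neg, abs_mul, abs_mul, ha, hb, one_mul, one_mul]
        exact (abs_apply_le_norm c j).trans hc1.le
    have h1 := abs_apply_add_le T he he' hyn m
    rw [hTy, hd, hc' m hk.symm, mul_zero, sub_zero, abs_one] at h1
    have hpos : 0 < |(T e).1 m| := abs_pos.2 hm
    have hy0 : 0 ≤ ‖y‖ * |(T e).1 m| := by positivity
    have hy_one : ‖y‖ = 1 := by linarith
    rw [hy_one] at h1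
    linarith
  have hv : |(T e).1 m| = 1 := by
    refine le_antisymm (hTe ▸ abs_apply_le_norm (T e) m) ?_
    rw [← hTe]
    refine norm_le_of_forall_abs_le _ (abs_nonneg _) fun k => ?_
    by_cases hk : k = m
    · rw [hk]
    · rw [hsupp k hk, abs_zero]; exact abs_nonneg _
  refine ⟨m, (T e).1 m, hv, fun x => ?_⟩
  have hyn : (x - x.1 n • e).1 n = 0 := by
    change x.1 n - x.1 n * e.1 n = 0
    rw [he, mul_one, sub_self]
  have h1 := abs_apply_add_le T he he' hyn m
  rw [hv, mul_one, add_le_iff_nonpos_left] at h1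
  have h2 : (T (x - x.1 n • e)).1 m = 0 := abs_nonpos_iff.1 h1
  rw [map_sub, map_smul] at h2
  have h3 : (T x).1 m - x.1 n * (T e).1 m = 0 := h2
  linarith

/-! ### The isomorphism of ideals induced by an isometry -/

theorem leftInverse_of_coord_eq (hI : ∀ A : Set ℕ, A.Finite → A ∈ I)
    (T : c0Ideal I ≃ₗᵢ[ℝ] c0Ideal J) {f g : ℕ → ℕ} {s t : ℕ → ℝ} (hs : ∀ n, |s n| = 1)
    (ht : ∀ n, |t n| = 1) (hf : ∀ n (x : c0Ideal I), (T x).1 (f n) = s n * x.1 n)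
    (hg : ∀ n (z : c0Ideal J), (T.symm z).1 (g n) = t n * z.1 n) : Function.LeftInverse g f := by
  intro n
  by_contra h
  obtain ⟨e, he, he', -⟩ := exists_unit hI n
  have h1 := hg (f n) (T e)
  rw [T.symm_apply_apply, hf, he, he' _ h, mul_one] at h1
  have h2 : |t (f n) * s n| = 1 := by rw [abs_mul, hs, ht, one_mul]
  rw [← h1, abs_zero] at h2
  exact zero_ne_one h2

/-- `T` maps the indicator sequence of `A` to a signed indicator sequence of `g ⁻¹' A`. -/
theorem preimage_mem_of_coord_eq (T : c0Ideal I ≃ₗᵢ[ℝ] c0Ideal J) {g : ℕ → ℕ} {t : ℕ → ℝ}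
    (ht : ∀ n, |t n| = 1) (hg : ∀ n (z : c0Ideal J), (T.symm z).1 (g n) = t n * z.1 n)
    {A : Set ℕ} (hA : A ∈ I) : g ⁻¹' A ∈ J := by
  refine J.lower (fun k hk => ?_) ((T (ind A hA)).2 1 one_pos)
  have h1 := hg k (T (ind A hA))
  rw [T.symm_apply_apply, ind_apply, Set.indicator_of_mem (Set.mem_preimage.1 hk)] at h1
  have h2 := congrArg abs h1
  rw [abs_mul, ht, one_mul, Pi.one_apply, abs_one] at h2
  change 1 ≤ |(T (ind A hA)).1 k - 0|
  rw [sub_zero, ← h2]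

theorem idealIsomorphic_of_linearIsometryEquiv (hI : ∀ A : Set ℕ, A.Finite → A ∈ I)
    (hJ : ∀ A : Set ℕ, A.Finite → A ∈ J) (T : c0Ideal I ≃ₗᵢ[ℝ] c0Ideal J) :
    IdealIsomorphic I J := by
  choose f s hs hf using exists_coord_eq hI hJ T
  choose g t ht hg using exists_coord_eq hJ hI T.symm
  have hgf : Function.LeftInverse g f := leftInverse_of_coord_eq hI T hs ht hf hg
  have hfg : Function.LeftInverse f g := leftInverse_of_coord_eq hJ T.symm ht hs hg hf
  refine ⟨f, ⟨hgf.injective, hfg.surjective⟩, fun A =>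
    ⟨fun hA => preimage_mem_of_coord_eq T.symm hs hf hA, fun hA => ?_⟩⟩
  have h := preimage_mem_of_coord_eq T ht hg hA
  rwa [← Set.preimage_comp, hfg.comp_eq_id, Set.preimage_id] at h

end c0Ideal

theorem mainTheorem1 (I J : Order.Ideal (Set ℕ))
    (hI : ∀ A : Set ℕ, A.Finite → A ∈ I) (hJ : ∀ A : Set ℕ, A.Finite → A ∈ J) :
    Nonempty (c0Ideal I ≃ₗᵢ[ℝ] c0Ideal J) ↔ IdealIsomorphic I J := by
  constructor
  · rintro ⟨T⟩
    exact c0Ideal.idealIsomorphic_of_linearIsometryEquiv hI hJ T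
  · rintro ⟨f, hf, h⟩
    exact ⟨(c0Ideal.compEquiv (Equiv.ofBijective f hf) h).symm⟩
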